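/- Let $\alpha>0$ and $\sigma>0$ be real numbers, put $\Lambda=\frac1\sigma\sqrt{\Gamma(3/\alpha)/\Gamma(1/\alpha)}$, and let $K_0(x)=\int_0^\infty e^{-x\cosh t}\,dt$ ($x>0$) be the modified Bessel function of the second kind of order $0$. Let $X_1,X_2,\dots$ be independent, identically distributed real random variables whose common law has the density $$f(z)=\frac{\alpha\Lambda^2}{\Gamma(1/\alpha)^2}\,K_0\bigl(2\Lambda^\alpha|z|^{\alpha/2}\bigr),\qquad z\in\mathbb R,$$ with respect to Lebesgue measure. Then $X_1$ is integrable with $$\mathbb E|X_1|=\frac{\Gamma(2/\alpha)^2}{\Lambda^2\,\Gamma(1/\alpha)^2},$$ and for every integer $n\ge 0$ the sum $S_n=\sum_{i=1}^n X_i$ is integrable and $$\mathbb E|S_n|\;\ge\;\sqrt n\,\mathbb E|X_1|\;=\;\sqrt n\,\frac{\Gamma(2/\alpha)^2}{\Lambda^2\,\Gamma(1/\alpha)^2}\;=\;\sqrt n\,\frac{\sigma^2\,\Gamma(2/\alpha)^2}{\Gamma(1/\alpha)\,\Gamma(3/\alpha)}.$$ -/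

import Mathlib

/-- The modified Bessel function of the second kind of order `0`, on the half-line `0 < x`,
through its standard integral representation `K₀(x) = ∫₀^∞ exp (-x cosh t) dt`.
(For `x ≤ 0` the integral diverges and the value is the irrelevant default `0`.) -/
noncomputable def besselK0 (x : ℝ) : ℝ :=
  ∫ t in Set.Ioi (0 : ℝ), Real.exp (-(x * Real.cosh t))

/-- The scale `Λ = σ⁻¹ √(Γ(3/α) / Γ(1/α))` of the generalized normal distribution with shape
`α` and standard deviation `σ`. -/
noncomputable def gndLambda (α σ : ℝ) : ℝ :=
  (1 / σ) * Real.sqrt (Real.Gamma (3 / α) / Real.Gamma (1 / α))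

/-- The density `z ↦ α Λ² / Γ(1/α)² * K₀(2 Λ^α |z|^(α/2))` of the product of two independent
centred generalized normal variables with shape `α` and standard deviation `σ`. -/
noncomputable def pgndPDF (α σ z : ℝ) : ℝ :=
  α * gndLambda α σ ^ 2 / Real.Gamma (1 / α) ^ 2 *
    besselK0 (2 * gndLambda α σ ^ α * |z| ^ (α / 2))

/-- The law on `ℝ` with density `pgndPDF α σ` with respect to Lebesgue measure. -/
noncomputable def pgndMeasure (α σ : ℝ) : MeasureTheory.Measure ℝ :=
  MeasureTheory.volume.withDensity (fun z => ENNReal.ofReal (pgndPDF α σ z))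

open MeasureTheory Set Filter Topology ProbabilityTheory

/-! Let `m = E|X₁|` and let `G` be a centred Gaussian of variance `π m² / 2`, so that `E|G| = m`.
The sum of `n` independent copies of `G` has mean absolute value exactly `√n m`, so it suffices that
replacing each `Xᵢ` by a copy of `G` does not increase the mean absolute value of the sum.

If `T` is the sum of the other terms, one replacement changes this mean by `E D(T)`, where `D(a) =
E|a + X₁| - E|a + G|`. `D` need not be nonnegative pointwise; what is shown is `∫₀ᴬ D ≥ 0` for all
`A ≥ 0`. This weaker property survives convolution with symmetric unimodal laws
(`HasNonnegCenteredIntegrals.convolve`) and forces `D 0 ≥ 0`; as `T` is a sum of symmetric unimodal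
variables, `E D(T) ≥ 0`.

Since `E|X₁| = E|G|`, the condition on `D` reads `E (A - |G|)₊² ≤ E (A - |X₁|)₊²`. The law of `X₁`
is that of `R U V`, with `U`, `V` uniform on `[-1, 1]` and `R` an independent random scale
(`lintegral_pgndMeasure`). By Jensen `R` may be replaced by its mean, which is `4m` because `E|U V|
= 1/4`. The parameters `α`, `σ` then only enter through `m`, and after rescaling there remains a
one-variable inequality (`truncSq_uniformMulMeasure`). -/

/-- Bounded continuous even functions with nonnegative integrals over centred intervals. -/
structure HasNonnegCenteredIntegrals (D : ℝ → ℝ) : Prop where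
  continuous : Continuous D
  bounded : ∃ C, ∀ x, |D x| ≤ C
  even : ∀ x, D (-x) = D x
  nonneg : ∀ A, 0 ≤ A → 0 ≤ ∫ x in (0 : ℝ)..A, D x

/-- Even functions on the line, nonincreasing on the half-line, that are densities (up to
normalization) of measures with a first moment. -/
structure IsSymmUnimodalDensity (q : ℝ → ℝ) : Prop where
  nonneg : ∀ x, 0 ≤ q x
  even : ∀ x, q (-x) = q x
  antitone : ∀ x y, 0 < x → x ≤ y → q y ≤ q x
  integrable : Integrable q
  integrable_mul : Integrable (fun x => x * q x)

/-! ### Functions with nonnegative centred integrals. -/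

namespace HasNonnegCenteredIntegrals

variable {D : ℝ → ℝ}

theorem apply_zero_nonneg (hD : HasNonnegCenteredIntegrals D) : 0 ≤ D 0 := by
  by_contra! h
  obtain ⟨ε, hε, hlt⟩ := Metric.eventually_nhds_iff.1
    (hD.continuous.continuousAt.eventually (gt_mem_nhds h))
  have h1 : 0 < ∫ x in (0 : ℝ)..(ε / 2), -D x := by
    refine intervalIntegral.intervalIntegral_pos_of_pos_on
      (hD.continuous.neg.intervalIntegrable _ _) (fun x hx => ?_) (by positivity)
    have : D x < 0 := hlt (by
      rw [Real.dist_eq, sub_zero, abs_of_pos hx.1]; linarith [hx.2])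
    linarith
  rw [intervalIntegral.integral_neg] at h1
  linarith [hD.nonneg (ε / 2) (by positivity)]

theorem primitive_neg (hD : HasNonnegCenteredIntegrals D) (y : ℝ) :
    ∫ x in (0 : ℝ)..(-y), D x = -∫ x in (0 : ℝ)..y, D x := by
  have h := intervalIntegral.integral_comp_neg (f := D) (a := 0) (b := y)
  simp only [hD.even, neg_zero] at h
  rw [h, intervalIntegral.integral_symm]

theorem primitive_nonpos (hD : HasNonnegCenteredIntegrals D) {y : ℝ} (hy : y ≤ 0) :
    ∫ x in (0 : ℝ)..y, D x ≤ 0 := by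
  have := hD.nonneg (-y) (by linarith)
  rw [hD.primitive_neg] at this
  linarith

theorem abs_primitive_le {C : ℝ} (hC : ∀ x, |D x| ≤ C) (y : ℝ) :
    |∫ x in (0 : ℝ)..y, D x| ≤ C * |y| := by
  have := intervalIntegral.norm_integral_le_of_norm_le_const (a := 0) (b := y) (f := D) (C := C)
    (fun x _ => hC x)
  simpa using this

theorem continuous_primitive (hD : HasNonnegCenteredIntegrals D) :
    Continuous fun y => ∫ x in (0 : ℝ)..y, D x :=
  intervalIntegral.continuous_primitive (fun _ _ => hD.continuous.intervalIntegrable _ _) 0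

/-- With the odd primitive `I y = ∫₀ʸ D`, Fubini gives `∫₀ᴬ (q-average of D) = ∫ q(x) I(x + A) dx`,
the term in `I(x)` vanishing by parity. Reflecting, translating and averaging turns this into `½ ∫
(q(y - A) - q(y + A)) I(y) dy`. Both factors have the sign of `y`: the first by unimodality, the
second by hypothesis. -/
theorem convolve (hD : HasNonnegCenteredIntegrals D) {q : ℝ → ℝ} (hq : IsSymmUnimodalDensity q) :
    HasNonnegCenteredIntegrals fun a => ∫ x, q x * D (a + x) := by
  obtain ⟨C, hC⟩ := hD.bounded
  have hC0 : 0 ≤ C := (abs_nonneg _).trans (hC 0)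
  have hbd : ∀ a x, ‖q x * D (a + x)‖ ≤ C * q x := fun a x => by
    rw [norm_mul, Real.norm_eq_abs, abs_of_nonneg (hq.nonneg x), mul_comm]
    exact mul_le_mul_of_nonneg_right (hC _) (hq.nonneg x)
  have hcomp : ∀ a, Continuous fun x => D (a + x) := fun a =>
    hD.continuous.comp (continuous_const.add continuous_id)
  refine ⟨?_, ⟨C * ∫ x, q x, fun a => ?_⟩, fun a => ?_, fun A hA => ?_⟩
  · refine continuous_of_dominated (bound := fun x => C * q x) (fun a => ?_)
      (fun a => ae_of_all _ (hbd a)) (hq.integrable.const_mul C) (ae_of_all _ fun x => ?_)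
    · exact hq.integrable.aestronglyMeasurable.mul (hcomp a).aestronglyMeasurable
    · exact continuous_const.mul (hD.continuous.comp (continuous_id.add continuous_const))
  · rw [← integral_const_mul]
    exact norm_integral_le_of_norm_le (hq.integrable.const_mul C) (ae_of_all _ (hbd a))
  · rw [← integral_neg_eq_self]
    refine integral_congr_ae (ae_of_all _ fun x => ?_)
    simp only [hq.even]
    rw [← hD.even]
    congr 2
    ring
  · set I : ℝ → ℝ := fun y => ∫ x in (0 : ℝ)..y, D x with hI
    have hIc : Continuous I := hD.continuous_primitive
    -- `I` grows at most linearly, so a first moment of `q` makes every integral below converge.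
    have hmom : Integrable fun x => (|x| + A) * q x := by
      have := hq.integrable_mul.norm.add (hq.integrable.const_mul A)
      refine this.congr (ae_of_all _ fun x => ?_)
      simp [abs_of_nonneg (hq.nonneg x)]
      ring
    have hqI : ∀ c, |c| ≤ A → Integrable fun x => q x * I (x + c) := fun c hc => by
      refine (hmom.const_mul C).mono' (hq.integrable.aestronglyMeasurable.mul
        (hIc.comp (continuous_id.add continuous_const)).aestronglyMeasurable)
        (ae_of_all _ fun x => ?_)
      rw [norm_mul, Real.norm_eq_abs, Real.norm_eq_abs, abs_of_nonneg (hq.nonneg x)]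
      have h1 := abs_primitive_le hC (x + c)
      have h2 : |x + c| ≤ |x| + A := (abs_add_le _ _).trans (by linarith)
      have h3 : |I (x + c)| ≤ C * (|x| + A) := h1.trans (by gcongr)
      calc q x * |I (x + c)| ≤ q x * (C * (|x| + A)) :=
            mul_le_mul_of_nonneg_left h3 (hq.nonneg x)
        _ = C * ((|x| + A) * q x) := by ring
    have hA' : |A| ≤ A := (abs_of_nonneg hA).le
    have hA'' : |-A| ≤ A := by rw [abs_neg]; exact hA'
    have h0A : |(0 : ℝ)| ≤ A := by simpa using hA
    have hswap : ∫ a in (0 : ℝ)..A, ∫ x, q x * D (a + x) = ∫ x, q x * (I (x + A) - I (x + 0)) := by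
      rw [intervalIntegral.integral_of_le hA, integral_integral_swap]
      · refine integral_congr_ae (ae_of_all _ fun x => ?_)
        dsimp only
        rw [integral_const_mul, ← intervalIntegral.integral_of_le hA,
          intervalIntegral.integral_comp_add_right (f := D), hI]
        dsimp only
        rw [intervalIntegral.integral_interval_sub_left (hD.continuous.intervalIntegrable _ _)
          (hD.continuous.intervalIntegrable _ _), zero_add, add_zero, add_comm x A]
      · refine Integrable.mono' (g := fun z : ℝ × ℝ => C * (1 * q z.2)) ?_ ?_
          (ae_of_all _ fun z => ?_)
        · exact (Integrable.mul_prod (μ := volume.restrict (Ioc 0 A)) (f := fun _ => (1 : ℝ))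
            (integrable_const 1) hq.integrable).const_mul C
        · exact (hq.integrable.aestronglyMeasurable.comp_snd).mul
            (hD.continuous.comp (continuous_fst.add continuous_snd)).aestronglyMeasurable
        · rw [one_mul]
          exact hbd z.1 z.2
    have hodd : ∫ x, q x * I (x + 0) = 0 := by
      have h := integral_neg_eq_self (fun x => q x * I (x + 0)) volume
      simp only [hq.even, add_zero, hI, hD.primitive_neg, mul_neg, integral_neg] at h ⊢
      linarith
    have hrefl : ∫ x, q x * I (x + A) = -∫ x, q x * I (x + -A) := by
      rw [← integral_neg_eq_self, ← integral_neg]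
      refine integral_congr_ae (ae_of_all _ fun x => ?_)
      simp only [hq.even, hI]
      rw [← mul_neg, ← hD.primitive_neg]
      congr 3
      ring
    have hs1 : ∫ x, q x * I (x + A) = ∫ y, q (y - A) * I y := by
      simpa using (integral_sub_right_eq_self (fun x => q x * I (x + A)) A).symm
    have hs2 : ∫ x, q x * I (x + -A) = ∫ y, q (y + A) * I y := by
      simpa using (integral_add_right_eq_self (fun x => q x * I (x + -A)) A).symm
    have hi1 : Integrable fun y => q (y - A) * I y := by
      simpa using (hqI A hA').comp_sub_right A
    have hi2 : Integrable fun y => q (y + A) * I y := by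
      simpa using (hqI (-A) hA'').comp_add_right A
    have hpos : 0 ≤ ∫ y, (q (y - A) * I y - q (y + A) * I y) := by
      refine integral_nonneg_of_ae ?_
      -- Monotonicity of `q` is assumed only off `0`: the Bessel density is infinite at `0`, where
      -- the formal value is `0`.
      have hne : ∀ᵐ y : ℝ, y ≠ A ∧ y ≠ -A :=
        (Measure.ae_ne volume A).and (Measure.ae_ne volume (-A))
      filter_upwards [hne] with y hy
      have habs : ∀ x, q |x| = q x := fun x => by
        rcases abs_choice x with h | h <;> simp [h, hq.even]
      rw [Pi.zero_apply, ← sub_mul]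
      rcases le_total 0 y with h | h
      · refine mul_nonneg ?_ (hD.nonneg y h)
        rw [← habs (y - A), ← habs (y + A)]
        refine sub_nonneg.2 (hq.antitone _ _ (abs_pos.2 (sub_ne_zero.2 hy.1)) ?_)
        rw [abs_of_nonneg (add_nonneg h hA), abs_le]
        constructor <;> linarith
      · refine mul_nonneg_of_nonpos_of_nonpos ?_ (hD.primitive_nonpos h)
        rw [← habs (y - A), ← habs (y + A)]
        refine sub_nonpos.2 (hq.antitone _ _ (abs_pos.2 ?_) ?_)
        · intro h0; exact hy.2 (by linarith)
        · rw [abs_of_nonpos (by linarith : y - A ≤ 0), abs_le]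
          constructor <;> linarith
    rw [integral_sub hi1 hi2] at hpos
    rw [hswap]
    simp only [mul_sub]
    rw [integral_sub (hqI A hA') (hqI 0 h0A), hodd]
    linarith

end HasNonnegCenteredIntegrals

/-! ### Centred positive measures, dual to the preceding class. -/

/-- Measures which integrate the functions of `HasNonnegCenteredIntegrals` to nonnegative
values; they include the symmetric unimodal laws and are stable under convolution with these. -/
def IsCenteredPositive (τ : Measure ℝ) : Prop :=
  ∀ D, HasNonnegCenteredIntegrals D → 0 ≤ ∫ x, D x ∂τ

theorem isCenteredPositive_dirac_zero : IsCenteredPositive (Measure.dirac 0) := fun D hD => by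
  rw [integral_dirac]
  exact hD.apply_zero_nonneg

theorem HasNonnegCenteredIntegrals.integrable {D : ℝ → ℝ} (hD : HasNonnegCenteredIntegrals D)
    (τ : Measure ℝ) [IsFiniteMeasure τ] : Integrable D τ := by
  obtain ⟨C, hC⟩ := hD.bounded
  exact (integrable_const C).mono' hD.continuous.aestronglyMeasurable (ae_of_all _ hC)

theorem integral_withDensity_ofReal {q : ℝ → ℝ} (hq : IsSymmUnimodalDensity q) (f : ℝ → ℝ) :
    ∫ x, f x ∂(volume.withDensity fun z => ENNReal.ofReal (q z)) = ∫ x, q x * f x := by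
  rw [integral_withDensity_eq_integral_toReal_smul₀
    hq.integrable.aestronglyMeasurable.aemeasurable.ennreal_ofReal
    (ae_of_all _ fun x => ENNReal.ofReal_lt_top)]
  refine integral_congr_ae (ae_of_all _ fun x => ?_)
  simp [ENNReal.toReal_ofReal (hq.nonneg x)]

theorem IsCenteredPositive.conv {τ : Measure ℝ} [IsProbabilityMeasure τ]
    (hτ : IsCenteredPositive τ) {q : ℝ → ℝ} (hq : IsSymmUnimodalDensity q)
    [IsProbabilityMeasure (volume.withDensity fun z => ENNReal.ofReal (q z))] :
    IsCenteredPositive (τ ∗ volume.withDensity fun z => ENNReal.ofReal (q z)) := fun D hD => by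
  rw [integral_conv (hD.integrable _)]
  simp only [integral_withDensity_ofReal hq]
  exact hτ _ (hD.convolve hq)

theorem isNegInvariant_withDensity_ofReal {q : ℝ → ℝ} (hq : ∀ x, q (-x) = q x) :
    (volume.withDensity fun z => ENNReal.ofReal (q z)).IsNegInvariant := by
  refine ⟨?_⟩
  ext s hs
  rw [Measure.neg, Measure.map_apply measurable_neg hs, withDensity_apply _ (measurable_neg hs),
    withDensity_apply _ hs, ← lintegral_indicator (measurable_neg hs), ← lintegral_indicator hs,
    ← lintegral_neg_eq_self]
  refine lintegral_congr fun x => ?_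
  by_cases h : x ∈ s <;> simp [indicator, h, hq]

/-! ### Mean distances and truncated squares. -/

/-- For `a ≥ 0` the two integrands add up to `2 max(a, |x|) = 2|x| + 2(a - |x|)₊`. -/
theorem integral_abs_add_add_integral_abs_sub (x A : ℝ) (hA : 0 ≤ A) :
    (∫ a in (0 : ℝ)..A, |a + x|) + ∫ a in (0 : ℝ)..A, |a + -x| =
      2 * A * |x| + max (A - |x|) 0 ^ 2 := by
  wlog hx : 0 ≤ x generalizing x
  · have := this (-x) (by linarith)
    rw [neg_neg, abs_neg] at this
    rw [add_comm, this]
  have hci : ∀ c a b : ℝ, IntervalIntegrable (fun t : ℝ => t + c) volume a b := fun c a b =>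
    Continuous.intervalIntegrable (by fun_prop) _ _
  have hai : ∀ c a b : ℝ, IntervalIntegrable (fun t : ℝ => |t + c|) volume a b := fun c a b =>
    Continuous.intervalIntegrable (by fun_prop) _ _
  have hpos : ∀ c a b : ℝ, a ≤ b → 0 ≤ a + c →
      ∫ t in a..b, |t + c| = (b ^ 2 - a ^ 2) / 2 + (b - a) * c := fun c a b hab h => by
    rw [intervalIntegral.integral_congr (g := fun t => t + c)]
    · rw [intervalIntegral.integral_add (Continuous.intervalIntegrable (by fun_prop) _ _)
        (by simp), integral_id]
      simp
    · intro t ht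
      rw [uIcc_of_le hab] at ht
      exact abs_of_nonneg (by linarith [ht.1])
  have hneg : ∀ c a b : ℝ, a ≤ b → b + c ≤ 0 →
      ∫ t in a..b, |t + c| = -((b ^ 2 - a ^ 2) / 2 + (b - a) * c) := fun c a b hab h => by
    rw [intervalIntegral.integral_congr (g := fun t => -(t + c))]
    · rw [intervalIntegral.integral_neg, intervalIntegral.integral_add
        (Continuous.intervalIntegrable (by fun_prop) _ _) (by simp), integral_id]
      simp
    · intro t ht
      rw [uIcc_of_le hab] at ht
      exact abs_of_nonpos (by linarith [ht.2])
  rw [hpos x 0 A hA (by linarith), abs_of_nonneg hx]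
  rcases le_total A x with h | h
  · rw [hneg (-x) 0 A hA (by linarith), max_eq_right (by linarith)]
    ring
  · rw [← intervalIntegral.integral_add_adjacent_intervals (hai (-x) 0 x) (hai (-x) x A),
      hneg (-x) 0 x hx (by linarith), hpos (-x) x A h (by linarith), max_eq_left (by linarith)]
    ring

/-- The mean distance `a ↦ E|a + X|` to a symmetric integrable variable, integrated. -/
theorem two_mul_intervalIntegral_integral_abs_add (μ : Measure ℝ) [IsProbabilityMeasure μ]
    [μ.IsNegInvariant] (hμ : Integrable (fun x => x) μ) {A : ℝ} (hA : 0 ≤ A) :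
    2 * ∫ a in (0 : ℝ)..A, ∫ x, |a + x| ∂μ =
      2 * A * (∫ x, |x| ∂μ) + ∫ x, max (A - |x|) 0 ^ 2 ∂μ := by
  have hprod : Integrable (fun z : ℝ × ℝ => |z.1 + z.2|)
      ((volume.restrict (Ioc 0 A)).prod μ) := by
    refine Integrable.abs ?_
    refine Integrable.add ?_ ?_
    · refine Integrable.comp_fst (f := fun x => x) ?_ μ
      exact (continuous_id.integrableOn_Icc (a := 0) (b := A)).mono_set Ioc_subset_Icc_self
    · exact hμ.comp_snd _
  have hswap : ∫ a in (0 : ℝ)..A, ∫ x, |a + x| ∂μ = ∫ x, (∫ a in (0 : ℝ)..A, |a + x|) ∂μ := by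
    simp only [intervalIntegral.integral_of_le hA]
    exact integral_integral_swap (f := fun a x => |a + x|) hprod
  have hint : Integrable (fun x => ∫ a in (0 : ℝ)..A, |a + x|) μ := by
    simp only [intervalIntegral.integral_of_le hA]
    exact hprod.integral_prod_right
  have hint' : Integrable (fun x => ∫ a in (0 : ℝ)..A, |a + -x|) μ := hint.comp_neg
  have hsq : Integrable (fun x => max (A - |x|) 0 ^ 2) μ := by
    refine (integrable_const (A ^ 2)).mono' (by fun_prop) (ae_of_all _ fun x => ?_)
    rw [Real.norm_eq_abs, abs_of_nonneg (by positivity)]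
    gcongr
    exact max_le (by linarith [abs_nonneg x]) hA
  have hrefl := integral_neg_eq_self (fun x => ∫ a in (0 : ℝ)..A, |a + x|) μ
  rw [hswap, two_mul]
  nth_rw 2 [← hrefl]
  rw [← integral_add hint hint', ← integral_const_mul, ← integral_add (hμ.abs.const_mul _) hsq]
  exact integral_congr_ae (ae_of_all _ fun x => integral_abs_add_add_integral_abs_sub x A hA)

theorem integrable_abs_add {μ : Measure ℝ} [IsProbabilityMeasure μ]
    (hμ : Integrable (fun x => x) μ) (a : ℝ) : Integrable (fun x => |a + x|) μ :=
  ((integrable_const a).add hμ).abs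

theorem continuous_integral_abs_add {μ : Measure ℝ} [IsProbabilityMeasure μ]
    (hμ : Integrable (fun x => x) μ) : Continuous fun a => ∫ x, |a + x| ∂μ := by
  refine LipschitzWith.continuous (K := 1) (LipschitzWith.of_dist_le_mul fun a b => ?_)
  rw [Real.dist_eq, ← integral_sub (integrable_abs_add hμ a) (integrable_abs_add hμ b)]
  have : ∀ᵐ x ∂μ, ‖|a + x| - |b + x|‖ ≤ dist a b := ae_of_all _ fun x => by
    rw [Real.norm_eq_abs, Real.dist_eq]
    exact (abs_abs_sub_abs_le _ _).trans (by simp)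
  simpa using norm_integral_le_of_norm_le (integrable_const (dist a b)) this

theorem abs_integral_abs_add_sub_le {μ : Measure ℝ} [IsProbabilityMeasure μ]
    (hμ : Integrable (fun x => x) μ) (a : ℝ) :
    abs ((∫ x, |a + x| ∂μ) - |a|) ≤ ∫ x, |x| ∂μ := by
  have h : ∫ x, (|a + x| - |a|) ∂μ = (∫ x, |a + x| ∂μ) - |a| := by
    rw [integral_sub (integrable_abs_add hμ a) (integrable_const _)]
    simp
  rw [← h, ← Real.norm_eq_abs]
  refine norm_integral_le_of_norm_le hμ.abs (ae_of_all _ fun x => ?_)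
  rw [Real.norm_eq_abs]
  exact (abs_abs_sub_abs_le _ _).trans (by simp)

theorem integral_abs_neg_add (μ : Measure ℝ) [μ.IsNegInvariant] (a : ℝ) :
    ∫ x, |-a + x| ∂μ = ∫ x, |a + x| ∂μ := by
  rw [← integral_neg_eq_self]
  refine integral_congr_ae (ae_of_all _ fun x => ?_)
  dsimp only
  rw [← neg_add, abs_neg]

/-- Equal first absolute moments cancel the linear terms of the integrated mean distances, leaving
half the difference of the truncated squares. Boundedness holds because each mean distance stays
within a constant of `|a|`. -/
theorem hasNonnegCenteredIntegrals_sub {μ γ : Measure ℝ} [IsProbabilityMeasure μ]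
    [IsProbabilityMeasure γ] [μ.IsNegInvariant] [γ.IsNegInvariant]
    (hμ : Integrable (fun x => x) μ) (hγ : Integrable (fun x => x) γ)
    (habs : ∫ x, |x| ∂μ = ∫ x, |x| ∂γ)
    (hle : ∀ A, 0 ≤ A → ∫ x, max (A - |x|) 0 ^ 2 ∂γ ≤ ∫ x, max (A - |x|) 0 ^ 2 ∂μ) :
    HasNonnegCenteredIntegrals fun a => (∫ x, |a + x| ∂μ) - ∫ x, |a + x| ∂γ := by
  have hcμ := continuous_integral_abs_add hμ
  have hcγ := continuous_integral_abs_add hγ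
  refine ⟨hcμ.sub hcγ, ⟨(∫ x, |x| ∂μ) + ∫ x, |x| ∂γ, fun a => ?_⟩, fun a => ?_, fun A hA => ?_⟩
  · have h1 := abs_le.1 (abs_integral_abs_add_sub_le hμ a)
    have h2 := abs_le.1 (abs_integral_abs_add_sub_le hγ a)
    exact abs_le.2 ⟨by linarith [h1.1, h2.2], by linarith [h1.2, h2.1]⟩
  · simp only [integral_abs_neg_add]
  · rw [intervalIntegral.integral_sub (hcμ.intervalIntegrable _ _) (hcγ.intervalIntegrable _ _)]
    have h1 := two_mul_intervalIntegral_integral_abs_add μ hμ hA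
    have h2 := two_mul_intervalIntegral_integral_abs_add γ hγ hA
    rw [habs] at h1
    linarith [hle A hA]

/-! ### Replacement of summands. -/

theorem integrable_id_conv {τ μ : Measure ℝ} [IsProbabilityMeasure τ] [IsProbabilityMeasure μ]
    (hτ : Integrable (fun x => x) τ) (hμ : Integrable (fun x => x) μ) :
    Integrable (fun x => x) (τ ∗ μ) := by
  rw [Measure.conv, integrable_map_measure (by fun_prop) (by fun_prop)]
  exact (hτ.comp_fst μ).add (hμ.comp_snd τ)

theorem integral_abs_conv_le {τ μ γ : Measure ℝ} [IsProbabilityMeasure τ]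
    [IsProbabilityMeasure μ] [IsProbabilityMeasure γ]
    (hτ : Integrable (fun x => x) τ) (hμ : Integrable (fun x => x) μ)
    (hγ : Integrable (fun x => x) γ) (hpos : IsCenteredPositive τ)
    (hD : HasNonnegCenteredIntegrals fun a => (∫ x, |a + x| ∂μ) - ∫ x, |a + x| ∂γ) :
    ∫ x, |x| ∂(τ ∗ γ) ≤ ∫ x, |x| ∂(τ ∗ μ) := by
  have h1 := (integrable_id_conv hτ hμ).abs
  have h2 := (integrable_id_conv hτ hγ).abs
  rw [integral_conv h1, integral_conv h2]
  have h := hpos _ hD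
  rw [integral_sub] at h
  · linarith
  · rw [Measure.conv, integrable_map_measure (by fun_prop) (by fun_prop)] at h1
    exact h1.integral_prod_left
  · rw [Measure.conv, integrable_map_measure (by fun_prop) (by fun_prop)] at h2
    exact h2.integral_prod_left

/-- Replacing the summands one at a time. -/
theorem integral_abs_iterate_conv_le {q r : ℝ → ℝ} {μ γ : Measure ℝ}
    (hq : IsSymmUnimodalDensity q) (hr : IsSymmUnimodalDensity r)
    (hμq : μ = volume.withDensity fun z => ENNReal.ofReal (q z))
    (hγr : γ = volume.withDensity fun z => ENNReal.ofReal (r z))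
    [IsProbabilityMeasure μ] [IsProbabilityMeasure γ]
    (hμ : Integrable (fun x => x) μ) (hγ : Integrable (fun x => x) γ)
    (hD : HasNonnegCenteredIntegrals fun a => (∫ x, |a + x| ∂μ) - ∫ x, |a + x| ∂γ)
    (n : ℕ) : ∀ (τ : Measure ℝ) [IsProbabilityMeasure τ], Integrable (fun x => x) τ →
      IsCenteredPositive τ →
      ∫ x, |x| ∂((· ∗ γ)^[n] τ) ≤ ∫ x, |x| ∂((· ∗ μ)^[n] τ) := by
  have hγn : ∀ (k : ℕ) (τ : Measure ℝ), IsProbabilityMeasure τ → Integrable (fun x => x) τ →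
      IsCenteredPositive τ → IsProbabilityMeasure ((· ∗ γ)^[k] τ) ∧
        Integrable (fun x => x) ((· ∗ γ)^[k] τ) ∧ IsCenteredPositive ((· ∗ γ)^[k] τ) := by
    intro k
    induction k with
    | zero => exact fun τ h1 h2 h3 => ⟨h1, h2, h3⟩
    | succ k ih =>
      intro τ h1 h2 h3
      refine ih (τ ∗ γ) inferInstance (integrable_id_conv h2 hγ) ?_
      subst hγr
      exact h3.conv hr
  induction n with
  | zero => exact fun τ _ _ _ => le_rfl
  | succ n ih =>
    intro τ _ h2 h3
    have hτμ : IsCenteredPositive (τ ∗ μ) := by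
      subst hμq
      exact h3.conv hq
    obtain ⟨i1, i2, i3⟩ := hγn n τ inferInstance h2 h3
    have hcomm : ∀ (k : ℕ) (τ : Measure ℝ) [IsProbabilityMeasure τ] (ν : Measure ℝ)
        [IsProbabilityMeasure ν], (· ∗ γ)^[k] (τ ∗ ν) = ((· ∗ γ)^[k] τ) ∗ ν := by
      intro k
      induction k with
      | zero => exact fun τ _ ν _ => rfl
      | succ k ih =>
        intro τ _ ν _
        rw [Function.iterate_succ_apply, Function.iterate_succ_apply, ← ih (τ ∗ γ) ν,
          Measure.conv_assoc, Measure.conv_comm ν γ, Measure.conv_assoc]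
    -- Induction started at `τ ∗ μ` handles the last `n` factors. What remains is to exchange one
    -- `μ` for `γ` next to `n` copies of `γ`; `hcomm` brings that factor to the end.
    have hstep := ih (τ ∗ μ) (integrable_id_conv h2 hμ) hτμ
    rw [Function.iterate_succ_apply, Function.iterate_succ_apply]
    refine le_trans ?_ hstep
    rw [hcomm, hcomm]
    exact integral_abs_conv_le i2 hμ hγ i3 hD

/-! ### The Bessel function as a logarithmic mixture. -/

theorem lintegral_comp_abs_eq_two_mul (f : ℝ → ENNReal) :
    ∫⁻ x, f |x| = 2 * ∫⁻ x in Ioi 0, f x := by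
  have h1 : ∫⁻ x in Ioi 0, f |x| = ∫⁻ x in Ioi 0, f x :=
    setLIntegral_congr_fun measurableSet_Ioi fun x hx => by rw [abs_of_pos hx]
  have h2 : ∫⁻ x in Iio 0, f |x| = ∫⁻ x in Ioi 0, f |x| := by
    rw [← lintegral_indicator measurableSet_Iio, ← lintegral_indicator measurableSet_Ioi,
      ← lintegral_neg_eq_self]
    refine lintegral_congr fun x => ?_
    simp [indicator]
  rw [← lintegral_add_compl _ measurableSet_Ioi, compl_Ioi, setLIntegral_congr Iio_ae_eq_Iic.symm,
    h2, h1, two_mul]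

/-- The exponential law of rate one. -/
noncomputable def unitExpMeasure : Measure ℝ :=
  (volume.restrict (Ioi 0)).withDensity fun b => ENNReal.ofReal (Real.exp (-b))

instance : SFinite unitExpMeasure := by
  unfold unitExpMeasure
  infer_instance

theorem ae_unitExpMeasure_pos : ∀ᵐ b ∂unitExpMeasure, 0 < b :=
  (withDensity_absolutelyContinuous _ _).ae_le (ae_restrict_mem measurableSet_Ioi)

theorem unitExpMeasure_Ioi {c : ℝ} (hc : 0 ≤ c) :
    unitExpMeasure (Ioi c) = ENNReal.ofReal (Real.exp (-c)) := by
  rw [unitExpMeasure, withDensity_apply _ measurableSet_Ioi,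
    Measure.restrict_restrict measurableSet_Ioi,
    inter_eq_self_of_subset_left (Ioi_subset_Ioi hc), ← integral_exp_neg_Ioi c,
    ofReal_integral_eq_lintegral_ofReal (integrableOn_exp_neg_Ioi c)
      (ae_of_all _ fun x => (Real.exp_pos _).le)]

theorem lintegral_rpow_unitExpMeasure {s : ℝ} (hs : 0 ≤ s) :
    ∫⁻ b, ENNReal.ofReal (b ^ s) ∂unitExpMeasure = ENNReal.ofReal (Real.Gamma (s + 1)) := by
  rw [unitExpMeasure, lintegral_withDensity_eq_lintegral_mul _ (by fun_prop) (by fun_prop),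
    Real.Gamma_eq_integral (by linarith), ofReal_integral_eq_lintegral_ofReal
      (Real.GammaIntegral_convergent (by linarith))]
  · refine setLIntegral_congr_fun measurableSet_Ioi fun x hx => ?_
    simp only [Pi.mul_apply, add_sub_cancel_right]
    rw [ENNReal.ofReal_mul (Real.exp_pos _).le]
  · filter_upwards [ae_restrict_mem measurableSet_Ioi] with x hx
    exact mul_nonneg (Real.exp_pos _).le (Real.rpow_nonneg (le_of_lt hx) _)

theorem integrableOn_exp_neg_mul_cosh {x : ℝ} (hx : 0 < x) :
    IntegrableOn (fun t => Real.exp (-(x * Real.cosh t))) (Ioi 0) := by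
  refine (integrableOn_exp_mul_Ioi (neg_lt_zero.2 hx) 0).mono'
    (Continuous.aestronglyMeasurable (by fun_prop)) ?_
  filter_upwards [ae_restrict_mem measurableSet_Ioi] with t ht
  rw [Real.norm_eq_abs, Real.abs_exp, Real.exp_le_exp, neg_mul, neg_le_neg_iff]
  have : t ≤ Real.cosh t := (Real.self_le_sinh_iff.2 (le_of_lt ht)).trans (Real.sinh_lt_cosh t).le
  gcongr

theorem besselK0_nonneg (x : ℝ) : 0 ≤ besselK0 x :=
  setIntegral_nonneg measurableSet_Ioi fun _ _ => (Real.exp_pos _).le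

theorem besselK0_antitone {x y : ℝ} (hx : 0 < x) (hxy : x ≤ y) : besselK0 y ≤ besselK0 x := by
  refine setIntegral_mono_on (integrableOn_exp_neg_mul_cosh (hx.trans_le hxy))
    (integrableOn_exp_neg_mul_cosh hx) measurableSet_Ioi fun t _ => ?_
  have := (Real.cosh_pos t).le
  gcongr

theorem measurable_besselK0 : Measurable besselK0 := by
  have : StronglyMeasurable fun x : ℝ =>
      ∫ t, Real.exp (-(x * Real.cosh t)) ∂(volume.restrict (Ioi 0)) :=
    StronglyMeasurable.integral_prod_right (f := fun x t => Real.exp (-(x * Real.cosh t)))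
      (Continuous.stronglyMeasurable (by fun_prop))
  exact this.measurable

/-- The Bessel function as a mixture of truncated logarithms. -/
theorem two_mul_ofReal_besselK0 {x : ℝ} (hx : 0 < x) :
    2 * ENNReal.ofReal (besselK0 (2 * x)) =
      ∫⁻ p, ENNReal.ofReal (Real.log p.1 + Real.log p.2 - 2 * Real.log x)
        ∂(unitExpMeasure.prod unitExpMeasure) := by
  set ν := unitExpMeasure.prod unitExpMeasure with hν
  -- The measure of `S` is computed by slicing in two ways. At fixed `t` the slice has mass `exp (-x
  -- eᵗ - x e⁻ᵗ) = exp (-2x cosh t)`; at fixed `p` it is an interval of length `(log p.1 + log p.2 -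
  -- 2 log x)₊`.
  set S : Set (ℝ × ℝ × ℝ) :=
    {z | x * Real.exp z.1 < z.2.1} ∩ {z | x * Real.exp (-z.1) < z.2.2} with hS
  have hSm : MeasurableSet S :=
    (measurableSet_lt (by fun_prop) (by fun_prop)).inter
      (measurableSet_lt (by fun_prop) (by fun_prop))
  have h1 : 2 * ENNReal.ofReal (besselK0 (2 * x)) = (volume.prod ν) S := by
    rw [besselK0, ofReal_integral_eq_lintegral_ofReal
      (integrableOn_exp_neg_mul_cosh (by positivity)) (ae_of_all _ fun t => (Real.exp_pos _).le),
      ← lintegral_comp_abs_eq_two_mul (fun t => ENNReal.ofReal (Real.exp (-(2 * x * Real.cosh t)))),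
      Measure.prod_apply hSm]
    refine lintegral_congr fun t => ?_
    have : Prod.mk t ⁻¹' S = Ioi (x * Real.exp t) ×ˢ Ioi (x * Real.exp (-t)) := by
      ext p; simp [hS]
    rw [this, hν, Measure.prod_prod, unitExpMeasure_Ioi (by positivity),
      unitExpMeasure_Ioi (by positivity), ← ENNReal.ofReal_mul (Real.exp_pos _).le,
      ← Real.exp_add, Real.cosh_abs, Real.cosh_eq]
    congr 2
    ring
  rw [h1, Measure.prod_apply_symm hSm]
  have hp1 : ∀ᵐ p ∂ν, 0 < p.1 := Measure.quasiMeasurePreserving_fst.ae ae_unitExpMeasure_pos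
  have hp2 : ∀ᵐ p ∂ν, 0 < p.2 := Measure.quasiMeasurePreserving_snd.ae ae_unitExpMeasure_pos
  refine lintegral_congr_ae ?_
  filter_upwards [hp1, hp2] with p h1 h2
  have : (fun t => (t, p)) ⁻¹' S = Ioo (Real.log (x / p.2)) (Real.log (p.1 / x)) := by
    ext t
    have hiff : x * Real.exp (-t) < p.2 ↔ x < Real.exp t * p.2 := by
      rw [Real.exp_neg, ← div_eq_mul_inv, div_lt_iff₀ (Real.exp_pos t), mul_comm]
    have hmem : (t, p) ∈ S ↔ x * Real.exp t < p.1 ∧ x * Real.exp (-t) < p.2 := Iff.rfl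
    rw [mem_preimage, hmem, mem_Ioo, Real.log_lt_iff_lt_exp (by positivity),
      Real.lt_log_iff_exp_lt (by positivity), lt_div_iff₀ hx, div_lt_iff₀ h2, hiff, and_comm,
      mul_comm x]
  rw [this, Real.volume_Ioo, Real.log_div h1.ne' hx.ne', Real.log_div hx.ne' h2.ne']
  congr 1
  ring

/-! ### The product law as a scale mixture. -/

/-- The law of the product of two independent uniform variables on `[-1, 1]`. -/
noncomputable def uniformMulMeasure : Measure ℝ :=
  volume.withDensity fun y => ENNReal.ofReal (-Real.log y / 2)

instance : SFinite uniformMulMeasure := by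
  unfold uniformMulMeasure
  infer_instance

/-- `Real.log` is even and `ENNReal.ofReal` annihilates `-log |y|` for `|y| > 1`, so the density is
even and lives on `[-1, 1]`; folding cancels the factor `1/2`. -/
theorem lintegral_uniformMulMeasure {F : ℝ → ENNReal} (hF : Measurable F) :
    ∫⁻ y, F |y| ∂uniformMulMeasure = ∫⁻ y in Ioi 0, F y * ENNReal.ofReal (-Real.log y) := by
  have h : ∫⁻ y, F |y| ∂uniformMulMeasure =
      ∫⁻ y, F |y| * ENNReal.ofReal (-Real.log |y| / 2) := by
    rw [uniformMulMeasure, lintegral_withDensity_eq_lintegral_mul _ (by fun_prop) (by fun_prop)]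
    refine lintegral_congr fun y => ?_
    rw [Pi.mul_apply, Real.log_abs, mul_comm]
  rw [h, lintegral_comp_abs_eq_two_mul (fun y => F y * ENNReal.ofReal (-Real.log y / 2)),
    ← lintegral_const_mul _ (by fun_prop)]
  refine lintegral_congr fun y => ?_
  rw [mul_left_comm, ← ENNReal.ofReal_ofNat 2, ← ENNReal.ofReal_mul (by norm_num)]
  congr 2
  ring

theorem lintegral_comp_mul_left_real (g : ℝ → ENNReal) (hg : Measurable g) {r : ℝ} (hr : 0 < r) :
    ∫⁻ z, g z = ENNReal.ofReal r * ∫⁻ y, g (r * y) := by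
  conv_lhs => rw [← Real.smul_map_volume_mul_left hr.ne', lintegral_smul_measure,
    lintegral_map hg (by fun_prop), abs_of_pos hr]
  rfl

theorem lintegral_mul_ofReal_log_sub_log_abs {F : ℝ → ENNReal} (hF : Measurable F) {r : ℝ}
    (hr : 0 < r) :
    ∫⁻ z, F |z| * ENNReal.ofReal (Real.log r - Real.log |z|) =
      ENNReal.ofReal (2 * r) * ∫⁻ y, F (r * |y|) ∂uniformMulMeasure := by
  rw [lintegral_comp_mul_left_real _ (by fun_prop) hr, uniformMulMeasure,
    lintegral_withDensity_eq_lintegral_mul _ (by fun_prop) (by fun_prop), mul_comm 2 r,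
    ENNReal.ofReal_mul hr.le, mul_assoc,
    ← lintegral_const_mul (ENNReal.ofReal 2) (by fun_prop)]
  congr 1
  refine lintegral_congr_ae ?_
  filter_upwards [Measure.ae_ne volume 0] with y hy
  rw [Pi.mul_apply, abs_mul, abs_of_pos hr, Real.log_mul hr.ne' (abs_pos.2 hy).ne', ← mul_assoc,
    ← ENNReal.ofReal_mul (by norm_num), mul_comm, Real.log_abs]
  congr 2
  ring

theorem gndLambda_pos {α σ : ℝ} (hα : 0 < α) (hσ : 0 < σ) : 0 < gndLambda α σ := by
  have h1 := Real.Gamma_pos_of_pos (show 0 < 3 / α by positivity)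
  have h2 := Real.Gamma_pos_of_pos (show 0 < 1 / α by positivity)
  unfold gndLambda
  positivity

/-- The random scale in the representation of the product law as a scale mixture. -/
noncomputable def pgndScale (α σ : ℝ) (p : ℝ × ℝ) : ℝ :=
  Real.exp ((Real.log p.1 + Real.log p.2) / α) / gndLambda α σ ^ 2

/-- The law of the parameter of `pgndScale`. -/
noncomputable def pgndMixing (α σ : ℝ) : Measure (ℝ × ℝ) :=
  (unitExpMeasure.prod unitExpMeasure).withDensity fun p =>
    ENNReal.ofReal (α * gndLambda α σ ^ 2 / Real.Gamma (1 / α) ^ 2 * α * pgndScale α σ p)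

theorem measurable_pgndScale (α σ : ℝ) : Measurable (pgndScale α σ) := by
  unfold pgndScale
  fun_prop

theorem measurable_pgndPDF (α σ : ℝ) : Measurable (pgndPDF α σ) :=
  (measurable_besselK0.comp (by fun_prop)).const_mul _

/-- At `x = Λ^α |z|^(α/2)` the logarithmic mixture has integrand `α (log R - log |z|)₊`, with `R`
the scale. This is `2αR` times the density of `R U V`; the factor `R` is absorbed as a tilt in
`pgndMixing`. -/
theorem lintegral_pgndMeasure {α σ : ℝ} (hα : 0 < α) (hσ : 0 < σ) {F : ℝ → ENNReal}
    (hF : Measurable F) :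
    ∫⁻ z, F |z| ∂pgndMeasure α σ =
      ∫⁻ p, ∫⁻ y, F (pgndScale α σ p * |y|) ∂uniformMulMeasure ∂pgndMixing α σ := by
  have hΛ := gndLambda_pos hα hσ
  have hR : ∀ p, 0 < pgndScale α σ p := fun p => by unfold pgndScale; positivity
  have hRm := measurable_pgndScale α σ
  set C := α * gndLambda α σ ^ 2 / Real.Gamma (1 / α) ^ 2 with hC
  have hC0 : 0 ≤ C := by positivity
  set ν := unitExpMeasure.prod unitExpMeasure with hν
  have hpdf : ∀ z : ℝ, z ≠ 0 → ENNReal.ofReal (pgndPDF α σ z) =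
      ENNReal.ofReal (C * α / 2) *
        ∫⁻ p, ENNReal.ofReal (Real.log (pgndScale α σ p) - Real.log |z|) ∂ν := fun z hz => by
    have hz' := abs_pos.2 hz
    have hx : 0 < gndLambda α σ ^ α * |z| ^ (α / 2) := by positivity
    have hK := two_mul_ofReal_besselK0 hx
    have hK' : ENNReal.ofReal (besselK0 (2 * (gndLambda α σ ^ α * |z| ^ (α / 2)))) =
        ENNReal.ofReal (1 / 2) * ∫⁻ p, ENNReal.ofReal (Real.log p.1 + Real.log p.2 -
          2 * Real.log (gndLambda α σ ^ α * |z| ^ (α / 2))) ∂ν := by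
      have h2 : ENNReal.ofReal (1 / 2) * 2 = 1 := by
        rw [← ENNReal.ofReal_ofNat 2, ← ENNReal.ofReal_mul (by norm_num)]
        norm_num
      rw [← hK, ← mul_assoc (ENNReal.ofReal (1 / 2)), h2, one_mul]
    rw [pgndPDF, ENNReal.ofReal_mul hC0, mul_assoc 2, hK', mul_div_assoc,
      ENNReal.ofReal_mul hC0, mul_assoc]
    congr 1
    have hhalf : ENNReal.ofReal (α / 2) = ENNReal.ofReal (1 / 2) * ENNReal.ofReal α := by
      rw [← ENNReal.ofReal_mul (by norm_num)]
      congr 1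
      ring
    rw [hhalf, mul_assoc, ← lintegral_const_mul (ENNReal.ofReal α) (by fun_prop)]
    congr 1
    refine lintegral_congr fun p => ?_
    rw [← ENNReal.ofReal_mul hα.le]
    congr 1
    rw [pgndScale, Real.log_div (Real.exp_ne_zero _) (by positivity), Real.log_exp,
      Real.log_mul (by positivity) (by positivity), Real.log_rpow hΛ, Real.log_rpow hz',
      Real.log_pow]
    field_simp
    push_cast
    ring
  rw [pgndMeasure, lintegral_withDensity_eq_lintegral_mul _
    (measurable_pgndPDF α σ).ennreal_ofReal (by fun_prop), pgndMixing,
    lintegral_withDensity_eq_lintegral_mul _ (by fun_prop)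
      (Measurable.lintegral_prod_right (by fun_prop))]
  have hstep : ∀ᵐ z : ℝ, ((fun z => ENNReal.ofReal (pgndPDF α σ z)) * fun z => F |z|) z =
      ∫⁻ p, ENNReal.ofReal (C * α / 2) *
        (F |z| * ENNReal.ofReal (Real.log (pgndScale α σ p) - Real.log |z|)) ∂ν := by
    filter_upwards [Measure.ae_ne volume 0] with z hz
    rw [Pi.mul_apply, hpdf z hz, lintegral_const_mul _ (by fun_prop),
      lintegral_const_mul _ (by fun_prop)]
    ring
  rw [lintegral_congr_ae hstep, lintegral_lintegral_swap (by fun_prop)]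
  refine lintegral_congr fun p => ?_
  rw [lintegral_const_mul _ (by fun_prop), lintegral_mul_ofReal_log_sub_log_abs hF (hR p),
    ← mul_assoc, ← ENNReal.ofReal_mul (by positivity), Pi.mul_apply]
  congr 2
  ring

/-! ### Truncated squares of the uniform product. -/

theorem lintegral_quadratic_mul_neg_log {B c₀ c₁ c₂ : ℝ} (hB : 0 < B) (hB1 : B ≤ 1)
    (hc : ∀ y ∈ Ioo 0 B, 0 ≤ c₀ + c₁ * y + c₂ * y ^ 2) :
    ∫⁻ y in Ioc 0 B, ENNReal.ofReal (c₀ + c₁ * y + c₂ * y ^ 2) * ENNReal.ofReal (-Real.log y) =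
      ENNReal.ofReal (c₀ * (B - B * Real.log B) + c₁ * (B ^ 2 / 4 - B ^ 2 / 2 * Real.log B) +
        c₂ * (B ^ 3 / 9 - B ^ 3 / 3 * Real.log B)) := by
  -- The antiderivative contains the logarithm only through `y * log y`, which is continuous at `0`.
  -- Integrability then follows from the sign of the derivative.
  set P : ℝ → ℝ := fun y => c₀ * (y - y * Real.log y) +
    c₁ * (y ^ 2 / 4 - y / 2 * (y * Real.log y)) +
    c₂ * (y ^ 3 / 9 - y ^ 2 / 3 * (y * Real.log y)) with hP
  set g : ℝ → ℝ := fun y => (c₀ + c₁ * y + c₂ * y ^ 2) * -Real.log y with hg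
  have hcont : Continuous P := by
    have := Real.continuous_mul_log
    fun_prop
  have hderiv : ∀ y ∈ Ioo 0 B, HasDerivAt P (g y) y := fun y hy => by
    have hy0 : y ≠ 0 := hy.1.ne'
    have hlog := Real.hasDerivAt_mul_log hy0
    have hid := hasDerivAt_id y
    have h := (((hid.sub hlog).const_mul c₀).add
      (((hid.pow 2).div_const 4).sub ((hid.div_const 2).mul hlog) |>.const_mul c₁)).add
      (((hid.pow 3).div_const 9).sub (((hid.pow 2).div_const 3).mul hlog) |>.const_mul c₂)
    refine HasDerivAt.congr_deriv (f := P) h ?_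
    simp only [hg, id, Pi.pow_apply]
    push_cast
    ring
  have hnn : ∀ y ∈ Ioo 0 B, 0 ≤ g y := fun y hy =>
    mul_nonneg (hc y hy) (neg_nonneg.2 (Real.log_nonpos hy.1.le (hy.2.le.trans hB1)))
  have hint : IntegrableOn g (Ioc 0 B) :=
    intervalIntegral.integrableOn_deriv_of_nonneg hcont.continuousOn hderiv hnn
  have hval : ∫ y in Ioc 0 B, g y = P B - P 0 := by
    rw [← intervalIntegral.integral_of_le hB.le]
    exact intervalIntegral.integral_eq_sub_of_hasDerivAt_of_le hB.le hcont.continuousOn hderiv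
      ((intervalIntegrable_iff_integrableOn_Ioc_of_le hB.le).2 hint)
  have hP0 : P 0 = 0 := by simp [hP]
  have hae : ∀ᵐ y ∂volume.restrict (Ioc 0 B), y ∈ Ioo 0 B := by
    rw [← restrict_Ioo_eq_restrict_Ioc]
    exact ae_restrict_mem measurableSet_Ioo
  calc ∫⁻ y in Ioc 0 B, ENNReal.ofReal (c₀ + c₁ * y + c₂ * y ^ 2) * ENNReal.ofReal (-Real.log y)
      = ∫⁻ y in Ioc 0 B, ENNReal.ofReal (g y) := by
        refine lintegral_congr_ae ?_
        filter_upwards [hae] with y hy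
        rw [← ENNReal.ofReal_mul (hc y hy)]
    _ = ENNReal.ofReal (P B - P 0) := by
        rw [← hval, ofReal_integral_eq_lintegral_ofReal hint (by
          filter_upwards [hae] with y hy using hnn y hy)]
    _ = _ := by
        rw [hP0, sub_zero, hP]
        congr 1
        ring

theorem setLIntegral_Ioi_mul_neg_log (F : ℝ → ENNReal) :
    ∫⁻ y in Ioi 0, F y * ENNReal.ofReal (-Real.log y) =
      ∫⁻ y in Ioc 0 1, F y * ENNReal.ofReal (-Real.log y) := by
  rw [← lintegral_indicator measurableSet_Ioi, ← lintegral_indicator measurableSet_Ioc]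
  refine lintegral_congr fun y => ?_
  by_cases h0 : 0 < y
  · by_cases h1 : y ≤ 1
    · simp [indicator, h0, h1]
    · have := Real.log_nonneg (not_le.1 h1).le
      simp [indicator, h0, h1, this]
  · simp [indicator, h0]

instance : IsProbabilityMeasure uniformMulMeasure := by
  refine ⟨?_⟩
  rw [← lintegral_one, lintegral_uniformMulMeasure (F := fun _ => 1) measurable_const,
    setLIntegral_Ioi_mul_neg_log]
  have h := lintegral_quadratic_mul_neg_log (B := 1) (c₀ := 1) (c₁ := 0) (c₂ := 0) one_pos le_rfl
    (fun _ _ => by norm_num)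
  simpa using h

theorem lintegral_abs_uniformMulMeasure :
    ∫⁻ y, ENNReal.ofReal |y| ∂uniformMulMeasure = ENNReal.ofReal (1 / 4) := by
  rw [lintegral_uniformMulMeasure (F := ENNReal.ofReal) (by fun_prop),
    setLIntegral_Ioi_mul_neg_log]
  have h := lintegral_quadratic_mul_neg_log (B := 1) (c₀ := 0) (c₁ := 1) (c₂ := 0) one_pos le_rfl
    (fun y hy => by simpa using hy.1.le)
  simpa using h

theorem truncSq_uniformMulMeasure_aux {A B : ℝ} (hB : 0 < B) (hB1 : B ≤ 1) (hBA : B ≤ A) :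
    ENNReal.ofReal (A ^ 2 * (B - B * Real.log B) + -2 * A * (B ^ 2 / 4 - B ^ 2 / 2 * Real.log B) +
        1 * (B ^ 3 / 9 - B ^ 3 / 3 * Real.log B)) ≤
      ∫⁻ y, ENNReal.ofReal (max (A - |y|) 0 ^ 2) ∂uniformMulMeasure := by
  have hq : ∀ y : ℝ, A ^ 2 + -2 * A * y + 1 * y ^ 2 = (A - y) ^ 2 := fun y => by ring
  rw [← lintegral_quadratic_mul_neg_log hB hB1 (fun y _ => by rw [hq]; positivity),
    lintegral_uniformMulMeasure (F := fun y => ENNReal.ofReal (max (A - y) 0 ^ 2)) (by fun_prop)]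
  refine le_trans (le_of_eq ?_) 
    (lintegral_mono_set (Ioc_subset_Ioi_self : Ioc 0 B ⊆ Ioi 0))
  refine setLIntegral_congr_fun measurableSet_Ioc fun y hy => ?_
  rw [hq, max_eq_left (by linarith [hy.2])]

/-- The right side is `E (B - |U V|)₊²` for `B ≤ 1`; the two terms of the minimum are the rescaled
Gaussian upper bounds. -/
theorem truncSq_bound_of_le_one {B : ℝ} (hB : 0 < B) (hB1 : B ≤ 1) :
    min (8 * B ^ 3 / (3 * Real.pi)) (B ^ 2 - B / 2 + Real.pi / 32) ≤
      B ^ 3 * (11 / 18 - Real.log B / 3) := by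
  -- This is `log (1 + x) ≥ 2x / (x + 2)` at `x = 1/B - 1`.
  have hlog : 2 * (1 - B) / (1 + B) ≤ -Real.log B := by
    have h := Real.le_log_one_add_of_nonneg (x := B⁻¹ - 1)
      (by rw [sub_nonneg]; exact (one_le_inv₀ hB).2 hB1)
    rw [add_sub_cancel, Real.log_inv] at h
    refine le_trans (le_of_eq ?_) h
    have h1 : B⁻¹ - 1 = (1 - B) / B := by field_simp
    have h2 : B⁻¹ - 1 + 2 = (1 + B) / B := by field_simp; ring
    rw [h2, h1]
    field_simp
  have hB3 : 0 < B ^ 3 := by positivity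
  -- Below the cut, `11/18 + 0.715/3 ≥ 0.8493 ≥ 8/(3π)` beats the cubic term; above it the logarithm
  -- bound reduces the quadratic term to a polynomial inequality.
  rcases le_total B 0.46 with h | h
  · refine (min_le_left _ _).trans ?_
    have h1 : (0.715 : ℝ) ≤ 2 * (1 - B) / (1 + B) := by
      rw [le_div_iff₀ (by positivity)]
      linarith
    have h2 : 8 / (3 * Real.pi) ≤ 0.8493 := by
      rw [div_le_iff₀ (by positivity)]
      linarith [Real.pi_gt_d2]
    calc 8 * B ^ 3 / (3 * Real.pi) = B ^ 3 * (8 / (3 * Real.pi)) := by ring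
      _ ≤ B ^ 3 * (11 / 18 - Real.log B / 3) := by
        refine mul_le_mul_of_nonneg_left ?_ hB3.le
        linarith
  · refine (min_le_right _ _).trans ?_
    have hpi : Real.pi / 32 ≤ 0.0982 := by linarith [Real.pi_lt_d2, Real.pi_lt_d4]
    have h1 : B ^ 3 * (11 / 18 + 2 * (1 - B) / (1 + B) / 3) ≤
        B ^ 3 * (11 / 18 - Real.log B / 3) := by
      refine mul_le_mul_of_nonneg_left ?_ hB3.le
      linarith
    refine le_trans ?_ h1
    have h2 : B ^ 3 * (11 / 18 + 2 * (1 - B) / (1 + B) / 3) =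
        B ^ 3 * (23 / 18 - B / 18) / (1 + B) := by
      field_simp
      ring
    rw [h2, le_div_iff₀ (by positivity)]
    have h3 : (B ^ 2 - B / 2 + 0.0982) * (1 + B) ≤ B ^ 3 * (23 / 18 - B / 18) := by
      nlinarith [mul_nonneg (sub_nonneg.2 h) (sub_nonneg.2 hB1),
        mul_nonneg (mul_nonneg (sub_nonneg.2 h) (sub_nonneg.2 hB1)) hB.le,
        sq_nonneg (B - 0.6), mul_nonneg hB.le (sq_nonneg (B - 0.6)), sq_nonneg (B * (B - 0.6))]
    refine le_trans ?_ h3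
    gcongr

theorem truncSq_uniformMulMeasure {B : ℝ} (hB : 0 < B) :
    ENNReal.ofReal (min (8 * B ^ 3 / (3 * Real.pi)) (B ^ 2 - B / 2 + Real.pi / 32)) ≤
      ∫⁻ y, ENNReal.ofReal (max (B - |y|) 0 ^ 2) ∂uniformMulMeasure := by
  rcases le_total B 1 with h | h
  · refine le_trans (ENNReal.ofReal_le_ofReal ?_) (truncSq_uniformMulMeasure_aux hB h le_rfl)
    refine (truncSq_bound_of_le_one hB h).trans (le_of_eq ?_)
    ring
  -- No truncation occurs on `[-1, 1]`, so the value is `B² - B/2 + 1/9`, and `1/9 ≥ π/32`.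
  · refine le_trans (ENNReal.ofReal_le_ofReal ?_)
      (truncSq_uniformMulMeasure_aux one_pos le_rfl h)
    refine (min_le_right _ _).trans ?_
    rw [Real.log_one]
    linarith [Real.pi_lt_d2]

theorem truncSq_uniformMulMeasure_scaled {ρ A : ℝ} (hρ : 0 < ρ) (hA : 0 < A) :
    ENNReal.ofReal (min (8 * A ^ 3 / (3 * Real.pi * ρ)) (A ^ 2 - A * ρ / 2 + Real.pi * ρ ^ 2 / 32)) ≤
      ∫⁻ y, ENNReal.ofReal (max (A - ρ * |y|) 0 ^ 2) ∂uniformMulMeasure := by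
  have h := truncSq_uniformMulMeasure (B := A / ρ) (by positivity)
  have h1 : ∀ y : ℝ, max (A - ρ * |y|) 0 ^ 2 = ρ ^ 2 * max (A / ρ - |y|) 0 ^ 2 := fun y => by
    rw [← mul_pow, mul_max_of_nonneg _ _ hρ.le, mul_zero, mul_sub, mul_div_cancel₀ _ hρ.ne']
  simp only [h1]
  have h2 : min (8 * A ^ 3 / (3 * Real.pi * ρ)) (A ^ 2 - A * ρ / 2 + Real.pi * ρ ^ 2 / 32) =
      ρ ^ 2 * min (8 * (A / ρ) ^ 3 / (3 * Real.pi))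
        ((A / ρ) ^ 2 - (A / ρ) / 2 + Real.pi / 32) := by
    rw [mul_min_of_nonneg _ _ (by positivity)]
    congr 1 <;> field_simp
  rw [h2, ENNReal.ofReal_mul (by positivity)]
  simp only [ENNReal.ofReal_mul (sq_nonneg ρ)]
  rw [lintegral_const_mul _ (by fun_prop)]
  gcongr

/-- Scale mixtures of products of uniform variables dominate, by Jensen's inequality, the
product with the mean scale. -/
theorem lintegral_truncSq_le_of_mixture {Θ : Type*} [MeasurableSpace Θ] {ν : Measure Θ}
    [IsProbabilityMeasure ν] {R : Θ → ℝ} (hR : Integrable R ν) (hRm : Measurable R)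
    (hR0 : ∀ p, 0 < R p) (A : ℝ) (hA : 0 ≤ A) :
    ∫⁻ y, ENNReal.ofReal (max (A - (∫ p, R p ∂ν) * |y|) 0 ^ 2) ∂uniformMulMeasure ≤
      ∫⁻ p, ∫⁻ y, ENNReal.ofReal (max (A - R p * |y|) 0 ^ 2) ∂uniformMulMeasure ∂ν := by
  rw [lintegral_lintegral_swap (by fun_prop)]
  refine lintegral_mono fun y => ?_
  have hle : ∀ p, max (A - R p * |y|) 0 ^ 2 ≤ A ^ 2 := fun p => by
    have := mul_nonneg (hR0 p).le (abs_nonneg y)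
    gcongr
    exact max_le (by linarith) hA
  have hint : Integrable (fun p => max (A - R p * |y|) 0 ^ 2) ν := by
    refine (integrable_const (A ^ 2)).mono' (by fun_prop) (ae_of_all _ fun p => ?_)
    rw [Real.norm_eq_abs, abs_of_nonneg (by positivity)]
    exact hle p
  rw [← ofReal_integral_eq_lintegral_ofReal hint (ae_of_all _ fun p => by positivity)]
  refine ENNReal.ofReal_le_ofReal ?_
  have hconv : ConvexOn ℝ univ fun r : ℝ => max (A - r * |y|) 0 ^ 2 := by
    refine ConvexOn.pow (ConvexOn.sup ⟨convex_univ, fun a _ b _ s t _ _ hst => ?_⟩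
      (convexOn_const 0 convex_univ)) (fun r _ => le_max_right _ _) 2
    simp only [smul_eq_mul]
    have : t = 1 - s := by linarith
    subst this
    exact le_of_eq (by ring)
  exact hconv.map_integral_le (by fun_prop) isClosed_univ (ae_of_all _ fun _ => mem_univ _) hR hint

/-! ### The Gaussian comparison law. -/

theorem isNegInvariant_gaussianReal (v : NNReal) : (gaussianReal 0 v).IsNegInvariant := by
  refine ⟨?_⟩
  rw [Measure.neg]
  have := gaussianReal_map_neg (μ := 0) (v := v)
  rwa [neg_zero] at this

theorem integrable_id_gaussianReal (v : NNReal) : Integrable (fun x => x) (gaussianReal 0 v) :=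
  (memLp_id_gaussianReal 1).integrable le_rfl

theorem integral_sq_gaussianReal (v : NNReal) : ∫ x, x ^ 2 ∂gaussianReal 0 v = v := by
  have h := variance_fun_id_gaussianReal (μ := 0) (v := v)
  rwa [variance_of_integral_eq_zero (by fun_prop) (integral_id_gaussianReal)] at h

theorem isSymmUnimodalDensity_gaussianPDFReal {v : NNReal} (hv : v ≠ 0) :
    IsSymmUnimodalDensity (gaussianPDFReal 0 v) where
  nonneg := gaussianPDFReal_nonneg 0 v
  even x := by simp [gaussianPDFReal]
  antitone x y hx hxy := by
    simp only [gaussianPDFReal, sub_zero]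
    gcongr
  integrable := integrable_gaussianPDFReal 0 v
  integrable_mul := by
    have h := integrable_id_gaussianReal v
    rw [gaussianReal_of_var_ne_zero 0 hv, integrable_withDensity_iff (measurable_gaussianPDF 0 v)
      (ae_of_all _ fun _ => gaussianPDF_lt_top)] at h
    simpa only [toReal_gaussianPDF] using h

theorem integral_abs_gaussianReal {v : NNReal} (hv : v ≠ 0) {m : ℝ} (hm : 0 < m)
    (hvm : (v : ℝ) = Real.pi * m ^ 2 / 2) : ∫ x, |x| ∂gaussianReal 0 v = m := by
  have hsq : √(2 * Real.pi * v) = Real.pi * m := by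
    rw [hvm, ← Real.sqrt_sq (show 0 ≤ Real.pi * m by positivity)]
    congr 1
    ring
  have hv0 : (0 : ℝ) < v := by positivity
  rw [integral_gaussianReal_eq_integral_smul hv]
  have h1 : ∀ x : ℝ, gaussianPDFReal 0 v x • |x| =
      (Real.pi * m)⁻¹ * (|x| ^ (1 : ℝ) * Real.exp (-(1 / (2 * v)) * |x| ^ (2 : ℝ))) := fun x => by
    rw [gaussianPDFReal, hsq, smul_eq_mul, Real.rpow_one, Real.rpow_two, sq_abs, sub_zero,
      mul_assoc, mul_comm |x|]
    congr 3
    ring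
  simp only [h1]
  rw [integral_const_mul, integral_comp_abs (f := fun x =>
    x ^ (1 : ℝ) * Real.exp (-(1 / (2 * v)) * x ^ (2 : ℝ))),
    integral_rpow_mul_exp_neg_mul_rpow (by norm_num) (by norm_num) (by positivity)]
  norm_num
  rw [hvm, Real.rpow_neg_one]
  field_simp

/-- The first bound replaces the density by its maximum `1/(π m)`; the second drops the truncation
and expands `(A - |x|)²`. -/
theorem integral_truncSq_gaussianReal_le {v : NNReal} (hv : v ≠ 0) {m : ℝ} (hm : 0 < m)
    (hvm : (v : ℝ) = Real.pi * m ^ 2 / 2) {A : ℝ} (hA : 0 ≤ A) :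
    ∫ x, max (A - |x|) 0 ^ 2 ∂gaussianReal 0 v ≤
      min (2 * A ^ 3 / (3 * Real.pi * m)) (A ^ 2 - 2 * A * m + Real.pi * m ^ 2 / 2) := by
  have hsq : √(2 * Real.pi * v) = Real.pi * m := by
    rw [hvm, ← Real.sqrt_sq (show 0 ≤ Real.pi * m by positivity)]
    congr 1
    ring
  refine le_min ?_ ?_
  · rw [integral_gaussianReal_eq_integral_smul hv]
    have hzero : ∀ x ∈ Ioi (0 : ℝ) \ Ioc 0 A, max (A - x) 0 ^ 2 = 0 := fun x hx => by
      have : A < x := not_le.1 fun h => hx.2 ⟨hx.1, h⟩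
      rw [max_eq_right (by linarith)]
      norm_num
    have hval : ∫ x : ℝ, max (A - |x|) 0 ^ 2 = 2 * (A ^ 3 / 3) := by
      rw [integral_comp_abs (f := fun x => max (A - x) 0 ^ 2),
        setIntegral_eq_of_subset_of_forall_sdiff_eq_zero measurableSet_Ioi Ioc_subset_Ioi_self hzero,
        ← intervalIntegral.integral_of_le hA,
        intervalIntegral.integral_congr (g := fun x => (A - x) ^ 2)]
      · rw [intervalIntegral.integral_comp_sub_left (fun x => x ^ 2), integral_pow]
        norm_num
      · intro x hx
        rw [uIcc_of_le hA] at hx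
        dsimp only
        rw [max_eq_left (by linarith [hx.2])]
    have hint : Integrable fun x : ℝ => max (A - |x|) 0 ^ 2 := by
      refine Continuous.integrable_of_hasCompactSupport (by fun_prop) ?_
      refine HasCompactSupport.intro (isCompact_Icc (a := -A) (b := A)) fun x hx => ?_
      have : A < |x| := not_le.1 fun h => hx (abs_le.1 h)
      rw [max_eq_right (by linarith)]
      norm_num
    calc ∫ x, gaussianPDFReal 0 v x • max (A - |x|) 0 ^ 2
        ≤ ∫ x : ℝ, (Real.pi * m)⁻¹ * max (A - |x|) 0 ^ 2 := by
          refine integral_mono_of_nonneg (ae_of_all _ fun x => ?_) (hint.const_mul _)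
            (ae_of_all _ fun x => ?_)
          · have := gaussianPDFReal_nonneg 0 v x
            simp only [Pi.zero_apply, smul_eq_mul]
            positivity
          · dsimp only
            rw [smul_eq_mul, gaussianPDFReal, hsq]
            refine mul_le_mul_of_nonneg_right ?_ (by positivity)
            refine mul_le_of_le_one_right (by positivity) (Real.exp_le_one_iff.2 ?_)
            refine div_nonpos_of_nonpos_of_nonneg (neg_nonpos.2 (sq_nonneg _)) (by positivity)
      _ = _ := by
          rw [integral_const_mul, hval]
          field_simp
  · have hid := integrable_id_gaussianReal v
    have hi2 : Integrable (fun x : ℝ => x ^ 2) (gaussianReal 0 v) :=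
      (memLp_id_gaussianReal 2).integrable_sq
    have hi : Integrable (fun x : ℝ => A ^ 2 - 2 * A * |x|) (gaussianReal 0 v) :=
      (integrable_const _).sub (hid.abs.const_mul _)
    calc ∫ x, max (A - |x|) 0 ^ 2 ∂gaussianReal 0 v
        ≤ ∫ x, (A ^ 2 - 2 * A * |x| + x ^ 2) ∂gaussianReal 0 v := by
          refine integral_mono_of_nonneg (ae_of_all _ fun x => by positivity)
            (hi.add hi2) (ae_of_all _ fun x => ?_)
          have h1 : A ^ 2 - 2 * A * |x| + x ^ 2 = (A - |x|) ^ 2 := by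
            rw [← sq_abs x]
            ring
          dsimp only
          rw [h1]
          rcases max_cases (A - |x|) 0 with h | h <;> rw [h.1]
          rw [zero_pow two_ne_zero]
          positivity
      _ = _ := by
          rw [integral_add hi hi2, integral_sub (integrable_const _) (hid.abs.const_mul _),
            integral_const_mul, integral_abs_gaussianReal hv hm hvm, integral_sq_gaussianReal, hvm]
          simp

theorem iterate_conv_gaussianReal (v : NNReal) (n : ℕ) :
    (· ∗ gaussianReal 0 v)^[n] (Measure.dirac 0) = gaussianReal 0 (n * v) := by
  induction n with
  | zero => simp
  | succ n ih =>
    rw [Function.iterate_succ_apply', ih, gaussianReal_conv_gaussianReal]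
    congr 1
    · simp
    · push_cast
      ring

/-! ### Moments of the scale and of the product law. -/

theorem pgndScale_pos {α σ : ℝ} (hα : 0 < α) (hσ : 0 < σ) (p : ℝ × ℝ) : 0 < pgndScale α σ p := by
  have := gndLambda_pos hα hσ
  unfold pgndScale
  positivity

/-- `R^k` is `Λ^(-2k)` times `(p.1 p.2)^(k/α)`, whose mean factors into two Gamma integrals. -/
theorem lintegral_pgndScale_pow {α σ : ℝ} (hα : 0 < α) (k : ℕ) :
    ∫⁻ p, ENNReal.ofReal (pgndScale α σ p ^ k) ∂(unitExpMeasure.prod unitExpMeasure) =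
      ENNReal.ofReal (Real.Gamma (k / α + 1) ^ 2 / gndLambda α σ ^ (2 * k)) := by
  have hk : 0 ≤ k / α := by positivity
  have hΓ : 0 ≤ Real.Gamma (k / α + 1) := (Real.Gamma_pos_of_pos (by positivity)).le
  have h2k : 0 ≤ (gndLambda α σ ^ (2 * k))⁻¹ := by
    rw [pow_mul]
    positivity
  have hp1 : ∀ᵐ p ∂unitExpMeasure.prod unitExpMeasure, 0 < p.1 :=
    Measure.quasiMeasurePreserving_fst.ae ae_unitExpMeasure_pos
  have hp2 : ∀ᵐ p ∂unitExpMeasure.prod unitExpMeasure, 0 < p.2 :=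
    Measure.quasiMeasurePreserving_snd.ae ae_unitExpMeasure_pos
  have hpt : ∀ᵐ p ∂unitExpMeasure.prod unitExpMeasure, ENNReal.ofReal (pgndScale α σ p ^ k) =
      ENNReal.ofReal (gndLambda α σ ^ (2 * k))⁻¹ *
        (ENNReal.ofReal (p.1 ^ (k / α)) * ENNReal.ofReal (p.2 ^ (k / α))) := by
    filter_upwards [hp1, hp2] with p h1 h2
    rw [← ENNReal.ofReal_mul (by positivity), ← ENNReal.ofReal_mul h2k]
    congr 1
    rw [pgndScale, div_pow, ← pow_mul, ← Real.exp_nat_mul, Real.rpow_def_of_pos h1,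
      Real.rpow_def_of_pos h2, ← Real.exp_add, div_eq_inv_mul]
    congr 2
    ring
  rw [lintegral_congr_ae hpt, lintegral_const_mul _ (by fun_prop),
    lintegral_prod_mul (f := fun b => ENNReal.ofReal (b ^ (k / α)))
      (g := fun b => ENNReal.ofReal (b ^ (k / α))) (by fun_prop) (by fun_prop),
    lintegral_rpow_unitExpMeasure hk, ← ENNReal.ofReal_mul hΓ, ← ENNReal.ofReal_mul h2k]
  congr 1
  ring

theorem Gamma_div_add_one {α : ℝ} (hα : 0 < α) {k : ℝ} (hk : 0 < k) :
    Real.Gamma (k / α + 1) = k / α * Real.Gamma (k / α) :=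
  Real.Gamma_add_one (by positivity)

theorem isProbabilityMeasure_pgndMixing {α σ : ℝ} (hα : 0 < α) (hσ : 0 < σ) :
    IsProbabilityMeasure (pgndMixing α σ) := by
  have hΛ := gndLambda_pos hα hσ
  have hΓ := Real.Gamma_pos_of_pos (show 0 < 1 / α by positivity)
  have hm := measurable_pgndScale α σ
  have h := lintegral_pgndScale_pow (σ := σ) hα 1
  refine ⟨?_⟩
  have hC : 0 ≤ α * gndLambda α σ ^ 2 / Real.Gamma (1 / α) ^ 2 * α := by positivity
  rw [pgndMixing, withDensity_apply _ MeasurableSet.univ, Measure.restrict_univ]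
  simp only [ENNReal.ofReal_mul hC]
  simp only [pow_one, Nat.cast_one] at h
  rw [lintegral_const_mul _ (by fun_prop), h, ← ENNReal.ofReal_mul hC,
    Gamma_div_add_one hα one_pos, ← ENNReal.ofReal_one]
  congr 1
  field_simp

/-- The first absolute moment of the product law. -/
noncomputable def pgndAbsMoment (α σ : ℝ) : ℝ :=
  Real.Gamma (2 / α) ^ 2 / (gndLambda α σ ^ 2 * Real.Gamma (1 / α) ^ 2)

theorem pgndAbsMoment_pos {α σ : ℝ} (hα : 0 < α) (hσ : 0 < σ) : 0 < pgndAbsMoment α σ := by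
  have hΛ := gndLambda_pos hα hσ
  have h1 := Real.Gamma_pos_of_pos (show 0 < 1 / α by positivity)
  have h2 := Real.Gamma_pos_of_pos (show 0 < 2 / α by positivity)
  unfold pgndAbsMoment
  positivity

/-- The mixing law is tilted by `R`, so its mean scale is a second moment under the exponential law.
-/
theorem lintegral_pgndScale_pgndMixing {α σ : ℝ} (hα : 0 < α) (hσ : 0 < σ) :
    ∫⁻ p, ENNReal.ofReal (pgndScale α σ p) ∂pgndMixing α σ =
      ENNReal.ofReal (4 * pgndAbsMoment α σ) := by
  have hΛ := gndLambda_pos hα hσ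
  have hΓ := Real.Gamma_pos_of_pos (show 0 < 1 / α by positivity)
  have hm := measurable_pgndScale α σ
  have hC : 0 ≤ α * gndLambda α σ ^ 2 / Real.Gamma (1 / α) ^ 2 * α := by positivity
  have hpt : ∀ p, ENNReal.ofReal (α * gndLambda α σ ^ 2 / Real.Gamma (1 / α) ^ 2 * α *
      pgndScale α σ p) * ENNReal.ofReal (pgndScale α σ p) =
      ENNReal.ofReal (α * gndLambda α σ ^ 2 / Real.Gamma (1 / α) ^ 2 * α) *
        ENNReal.ofReal (pgndScale α σ p ^ 2) := fun p => by
    have := (pgndScale_pos hα hσ p).le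
    rw [ENNReal.ofReal_mul hC, mul_assoc, ← ENNReal.ofReal_mul this, ← sq (pgndScale α σ p)]
  rw [pgndMixing, lintegral_withDensity_eq_lintegral_mul _ (by fun_prop) (by fun_prop)]
  simp only [Pi.mul_apply, hpt]
  have h := lintegral_pgndScale_pow (σ := σ) hα 2
  rw [lintegral_const_mul _ (by fun_prop), h, ← ENNReal.ofReal_mul hC, Nat.cast_ofNat,
    Gamma_div_add_one hα two_pos, pgndAbsMoment]
  congr 1
  field_simp
  norm_num

theorem integrable_pgndScale {α σ : ℝ} (hα : 0 < α) (hσ : 0 < σ) :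
    Integrable (pgndScale α σ) (pgndMixing α σ) := by
  refine ⟨(measurable_pgndScale α σ).aestronglyMeasurable, ?_⟩
  rw [hasFiniteIntegral_iff_ofReal (ae_of_all _ fun p => (pgndScale_pos hα hσ p).le),
    lintegral_pgndScale_pgndMixing hα hσ]
  exact ENNReal.ofReal_lt_top

theorem integral_pgndScale {α σ : ℝ} (hα : 0 < α) (hσ : 0 < σ) :
    ∫ p, pgndScale α σ p ∂pgndMixing α σ = 4 * pgndAbsMoment α σ := by
  have := pgndAbsMoment_pos hα hσ
  rw [integral_eq_lintegral_of_nonneg_ae (ae_of_all _ fun p => (pgndScale_pos hα hσ p).le)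
    (measurable_pgndScale α σ).aestronglyMeasurable, lintegral_pgndScale_pgndMixing hα hσ,
    ENNReal.toReal_ofReal (by positivity)]

theorem isProbabilityMeasure_pgndMeasure {α σ : ℝ} (hα : 0 < α) (hσ : 0 < σ) :
    IsProbabilityMeasure (pgndMeasure α σ) := by
  have := isProbabilityMeasure_pgndMixing hα hσ
  refine ⟨?_⟩
  rw [← lintegral_one, lintegral_pgndMeasure hα hσ (F := fun _ => 1) measurable_const]
  simp

theorem lintegral_abs_pgndMeasure {α σ : ℝ} (hα : 0 < α) (hσ : 0 < σ) :
    ∫⁻ z, ENNReal.ofReal |z| ∂pgndMeasure α σ = ENNReal.ofReal (pgndAbsMoment α σ) := by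
  have hm := measurable_pgndScale α σ
  rw [lintegral_pgndMeasure hα hσ (F := ENNReal.ofReal) (by fun_prop)]
  have h : ∀ p, ∫⁻ y, ENNReal.ofReal (pgndScale α σ p * |y|) ∂uniformMulMeasure =
      ENNReal.ofReal (pgndScale α σ p) * ENNReal.ofReal (1 / 4) := fun p => by
    simp only [ENNReal.ofReal_mul (pgndScale_pos hα hσ p).le]
    rw [lintegral_const_mul _ (by fun_prop), lintegral_abs_uniformMulMeasure]
  simp only [h]
  rw [lintegral_mul_const _ (by fun_prop), lintegral_pgndScale_pgndMixing hα hσ,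
    ← ENNReal.ofReal_mul (by linarith [pgndAbsMoment_pos hα hσ])]
  congr 1
  ring

theorem integrable_id_pgndMeasure {α σ : ℝ} (hα : 0 < α) (hσ : 0 < σ) :
    Integrable (fun x => x) (pgndMeasure α σ) := by
  refine ⟨by fun_prop, ?_⟩
  rw [hasFiniteIntegral_iff_norm]
  simp only [Real.norm_eq_abs]
  rw [lintegral_abs_pgndMeasure hα hσ]
  exact ENNReal.ofReal_lt_top

theorem integral_abs_pgndMeasure {α σ : ℝ} (hα : 0 < α) (hσ : 0 < σ) :
    ∫ x, |x| ∂pgndMeasure α σ = pgndAbsMoment α σ := by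
  rw [integral_eq_lintegral_of_nonneg_ae (ae_of_all _ fun _ => abs_nonneg _) (by fun_prop),
    lintegral_abs_pgndMeasure hα hσ, ENNReal.toReal_ofReal (pgndAbsMoment_pos hα hσ).le]

theorem pgndPDF_nonneg {α : ℝ} (hα : 0 < α) (σ z : ℝ) : 0 ≤ pgndPDF α σ z :=
  mul_nonneg (by positivity) (besselK0_nonneg _)

theorem isSymmUnimodalDensity_pgndPDF {α σ : ℝ} (hα : 0 < α) (hσ : 0 < σ) :
    IsSymmUnimodalDensity (pgndPDF α σ) where
  nonneg := pgndPDF_nonneg hα σ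
  even x := by simp [pgndPDF]
  antitone x y hx hxy := by
    have hΛ := gndLambda_pos hα hσ
    unfold pgndPDF
    rw [abs_of_pos hx, abs_of_pos (hx.trans_le hxy)]
    refine mul_le_mul_of_nonneg_left (besselK0_antitone (by positivity) ?_) (by positivity)
    gcongr
  integrable := by
    have := isProbabilityMeasure_pgndMeasure hα hσ
    refine ⟨(measurable_pgndPDF α σ).aestronglyMeasurable, ?_⟩
    rw [hasFiniteIntegral_iff_ofReal (ae_of_all _ (pgndPDF_nonneg hα σ))]
    have h := measure_lt_top (pgndMeasure α σ) univ
    rwa [pgndMeasure, withDensity_apply _ MeasurableSet.univ, Measure.restrict_univ] at h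
  integrable_mul := by
    have h := integrable_id_pgndMeasure hα hσ
    rw [pgndMeasure, integrable_withDensity_iff (measurable_pgndPDF α σ).ennreal_ofReal
      (ae_of_all _ fun _ => ENNReal.ofReal_lt_top)] at h
    simpa only [ENNReal.toReal_ofReal (pgndPDF_nonneg hα σ _)] using h

/-! ### Comparison with the Gaussian and conclusion. -/

theorem le_integral_truncSq_pgndMeasure {α σ : ℝ} (hα : 0 < α) (hσ : 0 < σ) {A : ℝ} (hA : 0 < A) :
    min (2 * A ^ 3 / (3 * Real.pi * pgndAbsMoment α σ))
        (A ^ 2 - 2 * A * pgndAbsMoment α σ + Real.pi * pgndAbsMoment α σ ^ 2 / 2) ≤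
      ∫ x, max (A - |x|) 0 ^ 2 ∂pgndMeasure α σ := by
  have := isProbabilityMeasure_pgndMixing hα hσ
  have := isProbabilityMeasure_pgndMeasure hα hσ
  have hm := pgndAbsMoment_pos hα hσ
  set m := pgndAbsMoment α σ
  have hint : Integrable (fun x => max (A - |x|) 0 ^ 2) (pgndMeasure α σ) := by
    refine (integrable_const (A ^ 2)).mono' (by fun_prop) (ae_of_all _ fun x => ?_)
    rw [Real.norm_eq_abs, abs_of_nonneg (by positivity)]
    gcongr
    exact max_le (by linarith [abs_nonneg x]) hA.le
  have h1 := truncSq_uniformMulMeasure_scaled (ρ := 4 * m) (by positivity) hA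
  have h2 := lintegral_truncSq_le_of_mixture (integrable_pgndScale hα hσ)
    (measurable_pgndScale α σ) (pgndScale_pos hα hσ) A hA.le
  rw [integral_pgndScale hα hσ, ← lintegral_pgndMeasure hα hσ
    (F := fun x => ENNReal.ofReal (max (A - x) 0 ^ 2)) (by fun_prop),
    ← ofReal_integral_eq_lintegral_ofReal hint (ae_of_all _ fun x => by positivity)] at h2
  have h3 := (ENNReal.ofReal_le_ofReal_iff (integral_nonneg fun x => by positivity)).1 (h1.trans h2)
  refine le_trans (le_of_eq ?_) h3
  congr 1
  · field_simp
    norm_num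
  · ring

theorem sqrt_mul_pgndAbsMoment_le {α σ : ℝ} (hα : 0 < α) (hσ : 0 < σ) (n : ℕ) :
    √n * pgndAbsMoment α σ ≤ ∫ x, |x| ∂((· ∗ pgndMeasure α σ)^[n] (Measure.dirac 0)) := by
  have := isProbabilityMeasure_pgndMeasure hα hσ
  have hm := pgndAbsMoment_pos hα hσ
  set m := pgndAbsMoment α σ with hmdef
  -- For `n = 0` the Gaussian sum is degenerate, outside the scope of `integral_abs_gaussianReal`.
  rcases Nat.eq_zero_or_pos n with rfl | hn
  · simp
  set v : NNReal := ⟨Real.pi * m ^ 2 / 2, by positivity⟩ with hvdef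
  have hvm : (v : ℝ) = Real.pi * m ^ 2 / 2 := rfl
  have hv : v ≠ 0 := by
    rw [← NNReal.coe_ne_zero, hvm]
    positivity
  have hq := isSymmUnimodalDensity_pgndPDF hα hσ
  have hr := isSymmUnimodalDensity_gaussianPDFReal hv
  have hγr : gaussianReal 0 v = volume.withDensity fun z => ENNReal.ofReal (gaussianPDFReal 0 v z) :=
    gaussianReal_of_var_ne_zero 0 hv
  have := isNegInvariant_gaussianReal v
  have : (pgndMeasure α σ).IsNegInvariant := isNegInvariant_withDensity_ofReal hq.even
  have hμ := integrable_id_pgndMeasure hα hσ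
  have hγ := integrable_id_gaussianReal v
  have hD := hasNonnegCenteredIntegrals_sub hμ hγ
    (by rw [integral_abs_pgndMeasure hα hσ, integral_abs_gaussianReal hv hm hvm])
    (fun A hA => by
      rcases hA.eq_or_lt with rfl | hA
      · simp
      · exact (integral_truncSq_gaussianReal_le hv hm hvm hA.le).trans
          (le_integral_truncSq_pgndMeasure hα hσ hA))
  have h := integral_abs_iterate_conv_le (μ := pgndMeasure α σ) hq hr rfl hγr hμ hγ hD n (Measure.dirac 0)
    (integrable_dirac (by simp)) isCenteredPositive_dirac_zero
  rw [iterate_conv_gaussianReal] at h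
  have hn' : (0 : ℝ) < n := by exact_mod_cast hn
  rwa [integral_abs_gaussianReal (v := n * v) (m := √n * m) (mul_ne_zero (by exact_mod_cast hn.ne') hv)
    (by positivity) (by
      rw [mul_pow, Real.sq_sqrt hn'.le]
      push_cast
      rw [hvm]
      ring)] at h

theorem map_sum_range_eq_iterate_conv {Ω : Type*} [MeasurableSpace Ω] {P : Measure Ω}
    [IsProbabilityMeasure P] {X : ℕ → Ω → ℝ} {μ : Measure ℝ} (hindep : iIndepFun X P)
    (hlaw : ∀ i, HasLaw (X i) μ P) (n : ℕ) :
    P.map (fun ω => ∑ i ∈ Finset.range n, X i ω) = (· ∗ μ)^[n] (Measure.dirac 0) := by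
  induction n with
  | zero => simp [Measure.map_const]
  | succ n ih =>
    have hm : ∀ i, AEMeasurable (X i) P := fun i => (hlaw i).aemeasurable
    have hms : AEMeasurable (fun ω => ∑ i ∈ Finset.range n, X i ω) P :=
      Finset.aemeasurable_fun_sum _ fun i _ => hm i
    have hi : IndepFun (fun ω => ∑ i ∈ Finset.range n, X i ω) (X n) P := by
      have := hindep.indepFun_finsetSum_of_notMem₀ hm (Finset.notMem_range_self (n := n))
      convert this using 1
      ext ω
      simp
    have h := hi.map_add_eq_map_conv_map₀ hms (hm n)
    rw [Function.iterate_succ_apply', ← ih, ← (hlaw n).map_eq, ← h]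
    congr 1
    ext ω
    simp [Finset.sum_range_succ]

theorem pgndAbsMoment_eq {α σ : ℝ} (hα : 0 < α) (hσ : 0 < σ) :
    pgndAbsMoment α σ =
      σ ^ 2 * Real.Gamma (2 / α) ^ 2 / (Real.Gamma (1 / α) * Real.Gamma (3 / α)) := by
  have h1 := Real.Gamma_pos_of_pos (show 0 < 1 / α by positivity)
  have h3 := Real.Gamma_pos_of_pos (show 0 < 3 / α by positivity)
  rw [pgndAbsMoment, gndLambda, mul_pow, Real.sq_sqrt (by positivity)]
  field_simp

theorem theorem8 {Ω : Type*} [MeasurableSpace Ω] (P : MeasureTheory.Measure Ω)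
    [MeasureTheory.IsProbabilityMeasure P] (α σ : ℝ) (hα : 0 < α) (hσ : 0 < σ)
    (X : ℕ → Ω → ℝ) (hindep : ProbabilityTheory.iIndepFun X P)
    (hlaw : ∀ i, ProbabilityTheory.HasLaw (X i) (pgndMeasure α σ) P) :
    (MeasureTheory.Integrable (X 0) P ∧
      ∫ ω, |X 0 ω| ∂P =
        Real.Gamma (2 / α) ^ 2 / (gndLambda α σ ^ 2 * Real.Gamma (1 / α) ^ 2)) ∧
    ∀ n : ℕ,
      MeasureTheory.Integrable (fun ω => ∑ i ∈ Finset.range n, X i ω) P ∧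
      Real.sqrt n * (∫ ω, |X 0 ω| ∂P) ≤ ∫ ω, |∑ i ∈ Finset.range n, X i ω| ∂P ∧
      Real.sqrt n *
          (Real.Gamma (2 / α) ^ 2 / (gndLambda α σ ^ 2 * Real.Gamma (1 / α) ^ 2)) ≤
        ∫ ω, |∑ i ∈ Finset.range n, X i ω| ∂P ∧
      Real.sqrt n *
          (Real.Gamma (2 / α) ^ 2 / (gndLambda α σ ^ 2 * Real.Gamma (1 / α) ^ 2)) =
        Real.sqrt n *
          (σ ^ 2 * Real.Gamma (2 / α) ^ 2 / (Real.Gamma (1 / α) * Real.Gamma (3 / α))) := by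
  have hint : ∀ i, Integrable (X i) P := fun i => by
    have h := integrable_id_pgndMeasure hα hσ
    rw [← (hlaw i).map_eq] at h
    exact (integrable_map_measure (by fun_prop) (hlaw i).aemeasurable).1 h
  have habs : ∫ ω, |X 0 ω| ∂P = pgndAbsMoment α σ := by
    rw [← integral_abs_pgndMeasure hα hσ, ← (hlaw 0).map_eq,
      integral_map (hlaw 0).aemeasurable (by fun_prop)]
  have hsum : ∀ n : ℕ, √n * pgndAbsMoment α σ ≤ ∫ ω, |∑ i ∈ Finset.range n, X i ω| ∂P := fun n => by
    have h := sqrt_mul_pgndAbsMoment_le hα hσ n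
    rwa [← map_sum_range_eq_iterate_conv hindep hlaw,
      integral_map (Finset.aemeasurable_fun_sum _ fun i _ => (hlaw i).aemeasurable)
        (by fun_prop)] at h
  refine ⟨⟨hint 0, habs⟩, fun n => ⟨integrable_finsetSum _ fun i _ => hint i, ?_, hsum n, ?_⟩⟩
  · rw [habs]
    exact hsum n
  · rw [← pgndAbsMoment_eq hα hσ, pgndAbsMoment]
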